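/- Work over $\mathbb C$. A nondegenerate conic in $\mathbb P^2$ is given by a symmetric $3\times 3$ matrix $A$ of rank $3$ up to scalar (the curve $u^{T}Au=0$). A conic in $\mathbb P^3$ is given by its disk quadric, a symmetric $4\times 4$ matrix $Q$ of rank $3$ up to scalar (the planes $p$ with $p^{T}Qp=0$ are those tangent to the conic); let $\mathscr Z$ be the variety of these, on which $\mathrm{PGL}_4$ acts by $Q\mapsto gQg^{T}$. A camera is a $3\times 4$ matrix $P$ of rank $3$; its centre is the point of $\mathbb P^3$ spanned by $\ker P$. A conic $Q$ whose plane does not contain the centre of $P$ has as its image the nondegenerate plane conic $A$ with $\operatorname{adj}(A)\propto PQP^{T}$, and the image $P(\mathcal C)$ of a $d$-tuple $\mathcal C$ of conics is formed componentwise. A rational function on $\mathscr Z^d$ is a quotient of two polynomials in the entries of $d$ symmetric $4\times 4$ matrices, multihomogeneous of the same multidegree, with denominator not identically zero on $\mathscr Z^d$; it is constant if it takes a single value wherever the denominator is nonzero. Let $K$ be a set of cameras. A rational function $f$ on $\mathscr Z^d$ *can be computed from the images by cameras in $K$* if there is a function $h$, defined on a nonempty Zariski-open set of $d$-tuples of nondegenerate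 plane conics (for instance a rational function $h$), such that $f(\mathcal C)=h(P(\mathcal C))$ for every $P\in K$ and every $\mathcal C\in\mathscr Z^d$ for which both sides are defined. For $d$-tuples $\mathcal A,\mathcal A'$ of nondegenerate plane conics write $\mathcal A\sim_K\mathcal A'$ if there are $P,P'\in K$ and $\mathcal C\in\mathscr Z^d$ with $P(\mathcal C)=\mathcal A$ and $P'(\mathcal C)=\mathcal A'$. **Theorem.** Let $d\ge 0$ and let $K$ be a set of cameras that contains, for every $o\in\mathbb C^3\subset\mathbb P^3$, at least one camera with centre $o$ (for instance all cameras, or all cameras $[\,I\mid -o\,]$ of fixed orientation). Then: 1. any two $d$-tuples of nondegenerate conics in $\mathbb P^2$ are equivalent under the equivalence relation generated by $\sim_K$; 2. every rational function on $\mathscr Z^d$ that can be computed from the images by cameras in $K$ (that is, independently of the camera position) is constant; 3. for every single camera $P$, every $\mathrm{PGL}_4$-invariant rational function on $\mathscr Z^d$ that can be computed from the images by the camera $P$ is constant. -/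

import Mathlib

open scoped LinearAlgebra.Projectivization

noncomputable section

namespace ConicImaging

/-- Complex symmetric `n × n` matrices of rank 3, up to a nonzero scalar.
For `n = 3` these are the nondegenerate conics `{u : uᵀ A u = 0}` in `ℙ²`, given by the matrix `A`
of the conic locus. For `n = 4` these are the disk quadrics, that is, the conics in `ℙ³`, given by
the matrix `Q` of the quadric envelope `{p : pᵀ Q p = 0}` consisting of all planes tangent to the
conic. -/
def Conic (n : ℕ) : Type :=
  {A : ℙ ℂ (Matrix (Fin n) (Fin n) ℂ) // A.rep.IsSymm ∧ A.rep.rank = 3}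

/-- Nondegenerate conics in `ℙ²` (conic loci). -/
abbrev PlaneConic : Type := Conic 3

/-- Conics in `ℙ³` (disk quadrics). -/
abbrev SpaceConic : Type := Conic 4

/-- A matrix representing a conic; it is determined up to a nonzero scalar. -/
def Conic.mat {n : ℕ} (A : Conic n) : Matrix (Fin n) (Fin n) ℂ := A.1.rep

/-- The conic represented by a symmetric matrix of rank 3. -/
def Conic.mk {n : ℕ} (M : Matrix (Fin n) (Fin n) ℂ) (hs : M.IsSymm) (hr : M.rank = 3) :
    Conic n :=
  have hM : M ≠ 0 := by
    rintro rfl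
    simp at hr
  ⟨Projectivization.mk ℂ M hM, by
    obtain ⟨a, ha⟩ := Projectivization.exists_smul_eq_mk_rep ℂ M hM
    rw [← ha]
    refine ⟨hs.smul _, ?_⟩
    have h1 : a • M = Matrix.scalar (Fin n) (a : ℂ) * M := by
      rw [Matrix.scalar_apply, ← Matrix.smul_eq_diagonal_mul]
      rfl
    rw [h1, Matrix.rank_mul_eq_right_of_isUnit_det _ _ (by simp), hr]⟩

/-- The action of a projective transformation `x ↦ g x` of `ℙ³` on conics; on disk quadrics it is
`Q ↦ g Q gᵀ`. Scalar matrices act trivially, so this is the action of `PGL₄`. -/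
def SpaceConic.transform (g : GL (Fin 4) ℂ) (C : SpaceConic) : SpaceConic :=
  Conic.mk (g.1 * C.mat * g.1.transpose)
    (by
      have h : C.mat.transpose = C.mat := C.2.1
      simp [Matrix.IsSymm, Matrix.transpose_mul, h, Matrix.mul_assoc])
    (by
      have hg : IsUnit g.1.det := (Matrix.isUnit_iff_isUnit_det _).1 g.isUnit
      rw [Matrix.rank_mul_eq_left_of_isUnit_det _ _ (by rwa [Matrix.det_transpose]),
        Matrix.rank_mul_eq_right_of_isUnit_det _ _ hg]
      exact C.2.2)

/-- A projective camera: a `3 × 4` matrix of rank 3, acting by `x ↦ P x` from `ℙ³` minus the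
centre of the camera to `ℙ²`. -/
structure Camera where
  mat : Matrix (Fin 3) (Fin 4) ℂ
  rank_eq : mat.rank = 3

/-- The camera is positioned at the point `o` of `ℂ³ ⊆ ℙ³`. -/
def Camera.IsAt (P : Camera) (o : Fin 3 → ℂ) : Prop :=
  P.mat.mulVec ![o 0, o 1, o 2, 1] = 0

/-- The nondegenerate plane conic `A` is the image of the space conic `C` under the camera `P`:
the envelope `adj A` of `A` and the disk quadric `Q` of `C` satisfy `adj A ∝ P Q Pᵀ`.
As `A` is nondegenerate, this forces the camera centre to lie outside the plane of `C`. -/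
def IsImage (P : Camera) (C : SpaceConic) (A : PlaneConic) : Prop :=
  ∃ k : ℂ, k ≠ 0 ∧ A.mat.adjugate = k • (P.mat * C.mat * P.mat.transpose)

/-- The relation `A ∼ A'` on `d`-tuples of plane conics: both are images of a common `d`-tuple of
space conics, each under a camera from the set `K`. -/
def ImagesOfCommonModel {d : ℕ} (K : Set Camera) (A A' : Fin d → PlaneConic) : Prop :=
  ∃ P ∈ K, ∃ P' ∈ K, ∃ C : Fin d → SpaceConic,
    (∀ i, IsImage P (C i) (A i)) ∧ (∀ i, IsImage P' (C i) (A' i))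

/-- The homogeneous coordinates (matrix entries) of a `d`-tuple of conics. -/
def coords {d n : ℕ} (C : Fin d → Conic n) : Fin d × Fin n × Fin n → ℂ :=
  fun v => (C v.1).mat v.2.1 v.2.2

/-- A polynomial in the entries of `d` matrices that is homogeneous of degree `e i` in the entries
of the `i`-th matrix, for every `i`. -/
def IsMultihomogeneous {d n : ℕ} (p : MvPolynomial (Fin d × Fin n × Fin n) ℂ)
    (e : Fin d → ℕ) : Prop :=
  p.IsWeightedHomogeneous (fun v => (Pi.single v.1 1 : Fin d → ℕ)) e

/-- A rational function on the variety of `d`-tuples of conics in `ℙ³`, written as a quotient of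
two multihomogeneous polynomials of the same multidegree whose denominator does not vanish
identically on the variety. -/
structure RationalFunction (d : ℕ) where
  num : MvPolynomial (Fin d × Fin 4 × Fin 4) ℂ
  den : MvPolynomial (Fin d × Fin 4 × Fin 4) ℂ
  degree : Fin d → ℕ
  num_hom : IsMultihomogeneous num degree
  den_hom : IsMultihomogeneous den degree
  den_ne : ∃ C : Fin d → SpaceConic, den.eval (coords C) ≠ 0

namespace RationalFunction

variable {d : ℕ}

/-- The points at which the quotient is defined. -/
def IsDefinedAt (f : RationalFunction d) (C : Fin d → SpaceConic) : Prop :=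
  f.den.eval (coords C) ≠ 0

/-- The value at a point; meaningful where the quotient is defined. -/
def value (f : RationalFunction d) (C : Fin d → SpaceConic) : ℂ :=
  f.num.eval (coords C) / f.den.eval (coords C)

/-- The rational function is constant. -/
def IsConstant (f : RationalFunction d) : Prop :=
  ∃ c : ℂ, ∀ C, f.IsDefinedAt C → f.value C = c

/-- The rational function is invariant under the action of `PGL₄`. -/
def IsInvariant (f : RationalFunction d) : Prop :=
  ∀ (g : GL (Fin 4) ℂ) (C : Fin d → SpaceConic), f.IsDefinedAt C →
    f.IsDefinedAt (fun i => (C i).transform g) →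
    f.value (fun i => (C i).transform g) = f.value C

/-- `f` can be computed from the image, in the same way for all cameras in the set `K`: there is a
function `h`, defined on a nonempty Zariski open set `w ≠ 0` of `d`-tuples of plane conics, such
that `f (C) = h (P (C))` for all `P` in `K`, wherever both sides are defined.
Any rational `h` is a special case. -/
def IsComputableFromImage (f : RationalFunction d) (K : Set Camera) : Prop :=
  ∃ (h : (Fin d → PlaneConic) → ℂ) (w : MvPolynomial (Fin d × Fin 3 × Fin 3) ℂ)
    (e : Fin d → ℕ), IsMultihomogeneous w e ∧
    (∃ A : Fin d → PlaneConic, w.eval (coords A) ≠ 0) ∧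
    ∀ P ∈ K, ∀ (C : Fin d → SpaceConic) (A : Fin d → PlaneConic),
      (∀ i, IsImage P (C i) (A i)) → f.IsDefinedAt C → w.eval (coords A) ≠ 0 →
      f.value C = h A

end RationalFunction

end ConicImaging

end

noncomputable section

namespace ConicImaging

/-! ### Symmetric factorizations and rank -/

section LinearAlgebra

open Matrix

/-! Every conic in space has a matrix `N * Nᵀ` with `N` of size 4 × 3, and its image under `P` has
envelope `(P * N) * (P * N)ᵀ`. Factors form a vector space, and `P * N` does not change when a
rank-one matrix `x uᵀ` is added to `N`, where `x` spans the kernel of `P`. The vector `u` may differ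
from one conic to another, but `x` is common to all.

For functions: a function computable from the image under `P`, pulled back to tuples of factors, is
therefore invariant under translation by `(x uᵢᵀ)ᵢ` (`isPreservedBy_translation`). If all affine
centres occur, these translations generate the whole vector space, so the function is constant
(`isConstant_of_isPreservedBy_translations`). For a single camera, conjugating by the linear group
carries `x` to every nonzero vector, so invariance supplies the missing centres.

For images: moving the factors along the kernel of one camera and viewing them by another replaces
invertible image factors `Hᵢ` by `Hᵢ + y uᵢᵀ` (`factorsEquivalent_of_eq_add`). With `u` supported at
one index this is left multiplication of one component by `1 + y wᵀ`. Such matrices generate GL₃, so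
all tuples are equivalent. -/

theorem exists_eq_mul_transpose {n r : ℕ} (M : Matrix (Fin n) (Fin n) ℂ) (hs : M.IsSymm)
    (hr : M.rank = r) : ∃ N : Matrix (Fin n) (Fin r) ℂ, M = N * Nᵀ := by
  set b := Pi.basisFun ℂ (Fin n)
  set B : LinearMap.BilinForm ℂ (Fin n → ℂ) := Matrix.toBilin b M
  have hBM : LinearMap.BilinForm.toMatrix b B = M := LinearMap.BilinForm.toMatrix_toBilin b M
  have hB : LinearMap.IsSymm B := by
    refine ⟨fun x y => ?_⟩
    simp only [B, b, Matrix.toBilin_basisFun, Matrix.toBilin'_apply', RingHom.id_apply]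
    rw [dotProduct_mulVec, ← mulVec_transpose, hs.eq, dotProduct_comm]
  let : Invertible (2 : ℂ) := invertibleOfNonzero two_ne_zero
  obtain ⟨v₀, hv₀⟩ := LinearMap.BilinForm.exists_orthogonal_basis hB
  have hn : Module.finrank ℂ (Fin n → ℂ) = n := by simp
  let v : Module.Basis (Fin n) ℂ (Fin n → ℂ) := v₀.reindex (finCongr hn)
  have hv : ∀ i j, i ≠ j → B (v i) (v j) = 0 := fun i j hij => by
    simpa [v] using hv₀ (i := (finCongr hn).symm i) (j := (finCongr hn).symm j) (by simpa using hij)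
  set D : Fin n → ℂ := fun i => B (v i) (v i)
  have hD : LinearMap.BilinForm.toMatrix v B = diagonal D := by
    ext i j
    by_cases hij : i = j
    · subst hij
      simp [D, LinearMap.BilinForm.toMatrix_apply]
    · simp [LinearMap.BilinForm.toMatrix_apply, hij, hv]
  have hM : M = (v.toMatrix b)ᵀ * diagonal D * v.toMatrix b := by
    rw [← hD, LinearMap.BilinForm.toMatrix_mul_basis_toMatrix, hBM]
  set G := v.toMatrix b
  have hG : IsUnit G.det := by
    have : Invertible G := v.invertibleToMatrix b
    exact Matrix.isUnit_det_of_invertible G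
  have hcard : Fintype.card {i // D i ≠ 0} = r := by
    rw [← hr, hM, rank_mul_eq_left_of_isUnit_det _ _ hG,
      rank_mul_eq_right_of_isUnit_det _ _ (by rwa [det_transpose]), rank_diagonal]
  let e : Fin r ≃ {i // D i ≠ 0} := (Fintype.equivFinOfCardEq hcard).symm
  choose s hs using fun i => IsAlgClosed.exists_pow_nat_eq (D i) (n := 2) (by norm_num)
  -- After diagonalization only the nonzero entries of `D` contribute; their square roots are
  -- absorbed into the columns of the factor.
  refine ⟨Matrix.of fun i k => G (e k) i * s (e k), ?_⟩
  ext i j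
  rw [hM, mul_apply, mul_apply]
  simp only [transpose_apply, mul_diagonal, of_apply]
  rw [e.sum_comp (fun k : {i // D i ≠ 0} => G k i * s k * (G k j * s k)),
    ← Finset.sum_subtype (Finset.univ.filter (D · ≠ 0)) (by simp)
      (fun k => G k i * s k * (G k j * s k)), Finset.sum_filter]
  refine Finset.sum_congr rfl fun k _ => ?_
  split_ifs with hk
  · rw [← hs k]
    ring
  · rw [not_not.1 hk]
    ring

theorem exists_right_inverse_of_rank_eq {m n : ℕ} {P : Matrix (Fin m) (Fin n) ℂ}
    (h : P.rank = m) : ∃ R : Matrix (Fin n) (Fin m) ℂ, P * R = 1 := by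
  rw [← mulVec_surjective_iff_exists_right_inverse]
  have h1 : LinearMap.range P.mulVecLin = ⊤ := by
    apply Submodule.eq_top_of_finrank_eq
    simpa [Matrix.rank] using h
  exact LinearMap.range_eq_top.1 h1

theorem det_ne_zero_of_rank_eq {n : ℕ} {A : Matrix (Fin n) (Fin n) ℂ} (h : A.rank = n) :
    A.det ≠ 0 := by
  obtain ⟨R, hR⟩ := exists_right_inverse_of_rank_eq h
  intro h0
  simpa [h0] using congrArg det hR

theorem rank_mul_transpose_eq {m n : ℕ} {P : Matrix (Fin m) (Fin n) ℂ}
    {N : Matrix (Fin n) (Fin m) ℂ} (h : (P * N).det ≠ 0) : (N * Nᵀ).rank = m := by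
  apply le_antisymm
  · exact (rank_mul_le_left _ _).trans (rank_le_width _)
  · have h1 : (P * N * (P * N)ᵀ).rank = m := by
      rw [rank_of_det_ne_zero (by rw [det_mul, det_transpose]; exact mul_ne_zero h h),
        Fintype.card_fin]
    have h2 : P * N * (P * N)ᵀ = P * (N * Nᵀ) * Pᵀ := by
      rw [transpose_mul]
      simp only [Matrix.mul_assoc]
    rw [h2] at h1
    exact h1.symm.le.trans ((rank_mul_le_left _ _).trans (rank_mul_le_right _ _))

end LinearAlgebra

/-! ### Polynomial functions and multihomogeneity -/

section PolynomialFunctions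

variable {σ τ : Type*}

/-- Polynomial functions on an affine space. -/
def IsPolynomialFun (f : (σ → ℂ) → ℂ) : Prop :=
  ∃ p : MvPolynomial σ ℂ, ∀ x, f x = MvPolynomial.eval x p

namespace IsPolynomialFun

theorem const (c : ℂ) : IsPolynomialFun (fun _ : σ → ℂ => c) :=
  ⟨MvPolynomial.C c, by simp⟩

theorem coord (v : σ) : IsPolynomialFun (fun x : σ → ℂ => x v) :=
  ⟨MvPolynomial.X v, by simp⟩

theorem add {f g : (σ → ℂ) → ℂ} (hf : IsPolynomialFun f) (hg : IsPolynomialFun g) :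
    IsPolynomialFun (fun x => f x + g x) := by
  obtain ⟨p, hp⟩ := hf
  obtain ⟨q, hq⟩ := hg
  exact ⟨p + q, by simp [hp, hq]⟩

theorem mul {f g : (σ → ℂ) → ℂ} (hf : IsPolynomialFun f) (hg : IsPolynomialFun g) :
    IsPolynomialFun (fun x => f x * g x) := by
  obtain ⟨p, hp⟩ := hf
  obtain ⟨q, hq⟩ := hg
  exact ⟨p * q, by simp [hp, hq]⟩

theorem sub {f g : (σ → ℂ) → ℂ} (hf : IsPolynomialFun f) (hg : IsPolynomialFun g) :
    IsPolynomialFun (fun x => f x - g x) := by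
  obtain ⟨p, hp⟩ := hf
  obtain ⟨q, hq⟩ := hg
  exact ⟨p - q, by simp [hp, hq]⟩

theorem sum {ι : Type*} {f : ι → (σ → ℂ) → ℂ} (s : Finset ι) (hf : ∀ i, IsPolynomialFun (f i)) :
    IsPolynomialFun (fun x => ∑ i ∈ s, f i x) := by
  choose p hp using hf
  exact ⟨∑ i ∈ s, p i, by simp [hp]⟩

theorem prod {ι : Type*} {f : ι → (σ → ℂ) → ℂ} (s : Finset ι) (hf : ∀ i, IsPolynomialFun (f i)) :
    IsPolynomialFun (fun x => ∏ i ∈ s, f i x) := by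
  choose p hp using hf
  exact ⟨∏ i ∈ s, p i, by simp [hp]⟩

theorem comp {f : (τ → ℂ) → ℂ} (hf : IsPolynomialFun f) {g : (σ → ℂ) → τ → ℂ}
    (hg : ∀ v, IsPolynomialFun (fun x => g x v)) : IsPolynomialFun (fun x => f (g x)) := by
  obtain ⟨p, hp⟩ := hf
  choose q hq using hg
  refine ⟨MvPolynomial.bind₁ q p, fun x => ?_⟩
  beta_reduce
  rw [hp, MvPolynomial.eval, MvPolynomial.eval, MvPolynomial.eval₂Hom_bind₁]
  congr 1
  congr 1
  funext v
  exact hq v x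

/-- Replaces Zariski density: an identity of polynomials need only be checked where a polynomial
that is not identically zero does not vanish. -/
theorem eq_zero_of_mul_eq_zero {f g : (σ → ℂ) → ℂ} (hf : IsPolynomialFun f)
    (hg : IsPolynomialFun g) (h : ∀ x, f x * g x = 0) (hne : ∃ x, f x ≠ 0) (x : σ → ℂ) :
    g x = 0 := by
  obtain ⟨p, hp⟩ := hf
  obtain ⟨q, hq⟩ := hg
  have hpq : p * q = 0 := MvPolynomial.funext fun x => by simpa [hp, hq] using h x
  rcases mul_eq_zero.1 hpq with h0 | h0
  · obtain ⟨y, hy⟩ := hne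
    simp [hp, h0] at hy
  · simp [hq, h0]

end IsPolynomialFun

end PolynomialFunctions

theorem IsMultihomogeneous.eval_smul {d n : ℕ} {p : MvPolynomial (Fin d × Fin n × Fin n) ℂ}
    {e : Fin d → ℕ} (hp : IsMultihomogeneous p e) (c : Fin d → ℂ)
    (x : Fin d × Fin n × Fin n → ℂ) :
    p.eval (fun v => c v.1 * x v) = (∏ i, c i ^ e i) * p.eval x := by
  rw [MvPolynomial.eval_eq', MvPolynomial.eval_eq', Finset.mul_sum]
  refine Finset.sum_congr rfl fun m hm => ?_
  have h := hp (MvPolynomial.mem_support_iff.1 hm)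
  have hc : ∏ v, c v.1 ^ m v = ∏ i, c i ^ e i := by
    rw [Fintype.prod_prod_type]
    refine Finset.prod_congr rfl fun i _ => ?_
    rw [Finset.prod_pow_eq_pow_sum _ _ (c i)]
    congr 1
    rw [← h, Finsupp.weight_apply, Finsupp.sum_fintype _ _ (by simp), Finset.sum_apply]
    simp only [Fintype.sum_prod_type, Pi.smul_apply]
    symm
    rw [Finset.sum_eq_single i]
    · simp
    · intro j _ hj
      simp [hj.symm]
    · simp
  simp only [mul_pow, Finset.prod_mul_distrib, hc]
  ring

open Matrix

/-! ### Conics and their images in terms of factors -/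

namespace Conic

theorem exists_mat_mk {n : ℕ} (M : Matrix (Fin n) (Fin n) ℂ) (hs : M.IsSymm) (hr : M.rank = 3) :
    ∃ a : ℂ, a ≠ 0 ∧ (Conic.mk M hs hr).mat = a • M := by
  have hM : M ≠ 0 := by
    rintro rfl
    simp at hr
  obtain ⟨a, ha⟩ := Projectivization.exists_smul_eq_mk_rep ℂ M hM
  exact ⟨a, a.ne_zero, ha.symm⟩

theorem eq_of_mat_eq_smul {n : ℕ} {A B : Conic n} {a : ℂ} (h : A.mat = a • B.mat) : A = B := by
  apply Subtype.ext
  rw [← A.1.mk_rep, ← B.1.mk_rep]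
  exact (Projectivization.mk_eq_mk_iff' ℂ _ _ A.1.rep_nonzero B.1.rep_nonzero).2 ⟨a, h.symm⟩

/-- The conic with matrix `N Nᵀ`. -/
def ofFactor {n : ℕ} (N : Matrix (Fin n) (Fin 3) ℂ) (h : (N * Nᵀ).rank = 3) : Conic n :=
  Conic.mk (N * Nᵀ) (by rw [Matrix.IsSymm, transpose_mul, transpose_transpose]) h

theorem exists_factor {n : ℕ} (C : Conic n) :
    ∃ N : Matrix (Fin n) (Fin 3) ℂ, C.mat = N * Nᵀ :=
  exists_eq_mul_transpose C.mat C.2.1 C.2.2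

end Conic

theorem det_mul_transpose_ne_zero {H : Matrix (Fin 3) (Fin 3) ℂ} (h : H.det ≠ 0) :
    (H * Hᵀ).det ≠ 0 := by
  rw [det_mul, det_transpose]
  exact mul_ne_zero h h

/-- The nondegenerate plane conic with envelope `H Hᵀ`. -/
def PlaneConic.ofEnvelope (H : Matrix (Fin 3) (Fin 3) ℂ) (h : H.det ≠ 0) : PlaneConic :=
  Conic.mk (H * Hᵀ).adjugate
    (by rw [Matrix.IsSymm, adjugate_transpose, (isSymm_mul_transpose_self H).eq])
    (by
      rw [rank_of_det_ne_zero, Fintype.card_fin]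
      rw [det_adjugate]
      exact pow_ne_zero _ (det_mul_transpose_ne_zero h))

theorem PlaneConic.exists_mat_ofEnvelope (H : Matrix (Fin 3) (Fin 3) ℂ) (h : H.det ≠ 0) :
    ∃ a : ℂ, a ≠ 0 ∧ (PlaneConic.ofEnvelope H h).mat = a • (H * Hᵀ).adjugate :=
  Conic.exists_mat_mk _ _ _

theorem PlaneConic.det_ne_zero (A : PlaneConic) : A.mat.det ≠ 0 :=
  det_ne_zero_of_rank_eq A.2.2

theorem PlaneConic.exists_adjugate_eq (A : PlaneConic) :
    ∃ H : Matrix (Fin 3) (Fin 3) ℂ, H.det ≠ 0 ∧ A.mat.adjugate = H * Hᵀ := by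
  have hA := A.det_ne_zero
  have hd : A.mat.adjugate.det ≠ 0 := by
    rw [det_adjugate]
    exact pow_ne_zero _ hA
  obtain ⟨H, hH⟩ := exists_eq_mul_transpose (r := 3) A.mat.adjugate
    (by rw [Matrix.IsSymm, adjugate_transpose]; exact congrArg _ A.2.1)
    (by rw [rank_of_det_ne_zero hd, Fintype.card_fin])
  refine ⟨H, fun h0 => hd ?_, hH⟩
  rw [hH, det_mul, h0, zero_mul]

theorem PlaneConic.adjugate_adjugate_mat (A : PlaneConic) :
    A.mat.adjugate.adjugate = A.mat.det • A.mat := by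
  simpa using adjugate_adjugate' A.mat

theorem PlaneConic.exists_eq_ofEnvelope (A : PlaneConic) :
    ∃ (H : Matrix (Fin 3) (Fin 3) ℂ) (h : H.det ≠ 0), A = PlaneConic.ofEnvelope H h := by
  obtain ⟨H, h, hH⟩ := A.exists_adjugate_eq
  refine ⟨H, h, ?_⟩
  obtain ⟨a, -, hm⟩ := PlaneConic.exists_mat_ofEnvelope H h
  rw [← hH, A.adjugate_adjugate_mat, smul_smul] at hm
  exact (Conic.eq_of_mat_eq_smul hm).symm

theorem isImage_ofEnvelope {P : Camera} {N : Matrix (Fin 4) (Fin 3) ℂ}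
    {H : Matrix (Fin 3) (Fin 3) ℂ} (h : H.det ≠ 0) (hPN : P.mat * N = H)
    (hN : (N * Nᵀ).rank = 3) :
    IsImage P (Conic.ofFactor N hN) (PlaneConic.ofEnvelope H h) := by
  obtain ⟨a, ha, hA⟩ := PlaneConic.exists_mat_ofEnvelope H h
  obtain ⟨b, hb, hC⟩ : ∃ b : ℂ, b ≠ 0 ∧ (Conic.ofFactor N hN).mat = b • (N * Nᵀ) :=
    Conic.exists_mat_mk _ _ _
  have hd := det_mul_transpose_ne_zero h
  have hB : P.mat * (N * Nᵀ) * P.matᵀ = H * Hᵀ := by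
    rw [← hPN, transpose_mul]
    simp only [Matrix.mul_assoc]
  -- In size 3, `adj (a • adj B) = (a ^ 2 * det B) • B`; the factor `b⁻¹` undoes the scaling of the
  -- representative of the space conic.
  refine ⟨a ^ 2 * (H * Hᵀ).det * b⁻¹, by positivity, ?_⟩
  have haa : (H * Hᵀ).adjugate.adjugate = (H * Hᵀ).det • (H * Hᵀ) := by
    simpa using adjugate_adjugate' (H * Hᵀ)
  rw [hA, hC, adjugate_smul, haa, Matrix.mul_smul, Matrix.smul_mul, hB, smul_smul, smul_smul,
    Fintype.card_fin, mul_assoc, mul_assoc, inv_mul_cancel₀ hb, mul_one]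

/-- A `d`-tuple of `4 × 3` matrices, from its entries. -/
def slice {d : ℕ} (X : Fin d × Fin 4 × Fin 3 → ℂ) (i : Fin d) : Matrix (Fin 4) (Fin 3) ℂ :=
  Matrix.of fun a b => X (i, a, b)

/-- The entries of the matrices `N Nᵀ`, for a tuple of matrices `N` given by its entries. -/
def gram {d : ℕ} (X : Fin d × Fin 4 × Fin 3 → ℂ) : Fin d × Fin 4 × Fin 4 → ℂ :=
  fun v => (slice X v.1 * (slice X v.1)ᵀ) v.2.1 v.2.2

theorem exists_coords_eq_gram {d : ℕ} (C : Fin d → SpaceConic) :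
    ∃ X : Fin d × Fin 4 × Fin 3 → ℂ, coords C = gram X := by
  choose N hN using fun i => (C i).exists_factor
  refine ⟨fun v => N v.1 v.2.1 v.2.2, ?_⟩
  funext v
  exact congrFun (congrFun (hN v.1) v.2.1) v.2.2

section Polynomiality

variable {σ : Type*}

/-- A matrix whose entries are polynomial functions. -/
def IsPolynomialMatrix {m n : ℕ} (M : (σ → ℂ) → Matrix (Fin m) (Fin n) ℂ) : Prop :=
  ∀ i j, IsPolynomialFun fun x => M x i j

namespace IsPolynomialMatrix

theorem mul {l m n : ℕ} {M : (σ → ℂ) → Matrix (Fin l) (Fin m) ℂ}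
    {N : (σ → ℂ) → Matrix (Fin m) (Fin n) ℂ} (hM : IsPolynomialMatrix M)
    (hN : IsPolynomialMatrix N) : IsPolynomialMatrix fun x => M x * N x := fun i j => by
  simp only [mul_apply]
  exact .sum _ fun k => (hM i k).mul (hN k j)

theorem const {m n : ℕ} (M : Matrix (Fin m) (Fin n) ℂ) :
    IsPolynomialMatrix fun _ : σ → ℂ => M := fun i j => .const (M i j)

theorem transpose {m n : ℕ} {M : (σ → ℂ) → Matrix (Fin m) (Fin n) ℂ}
    (hM : IsPolynomialMatrix M) : IsPolynomialMatrix fun x => (M x)ᵀ := fun i j => hM j i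

theorem det {n : ℕ} {M : (σ → ℂ) → Matrix (Fin n) (Fin n) ℂ} (hM : IsPolynomialMatrix M) :
    IsPolynomialFun fun x => (M x).det := by
  simp only [det_apply']
  exact .sum _ fun s => (IsPolynomialFun.const _).mul (.prod _ fun i => hM _ _)

theorem adjugate {n : ℕ} {M : (σ → ℂ) → Matrix (Fin n) (Fin n) ℂ} (hM : IsPolynomialMatrix M) :
    IsPolynomialMatrix fun x => (M x).adjugate := fun i j => by
  simp only [adjugate_apply]
  refine det fun a b => ?_
  by_cases h : a = j
  · subst h
    simpa using .const _
  · simpa [updateRow_ne h] using hM a b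

end IsPolynomialMatrix

theorem isPolynomialMatrix_slice {d : ℕ} (i : Fin d) : IsPolynomialMatrix (slice (d := d) · i) :=
  fun a b => .coord (i, a, b)

theorem isPolynomialFun_gram {d : ℕ} (v : Fin d × Fin 4 × Fin 4) :
    IsPolynomialFun (gram (d := d) · v) :=
  (isPolynomialMatrix_slice v.1).mul (isPolynomialMatrix_slice v.1).transpose v.2.1 v.2.2

theorem isPolynomialFun_eval (p : MvPolynomial σ ℂ) : IsPolynomialFun fun x => p.eval x :=
  ⟨p, fun _ => rfl⟩

end Polynomiality

/-! ### Pullback of rational functions to factors -/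

namespace RationalFunction

variable {d : ℕ} (f : RationalFunction d)

/-- The numerator, as a function of the factors `N` of the matrices `N Nᵀ`. -/
def numFun (X : Fin d × Fin 4 × Fin 3 → ℂ) : ℂ := f.num.eval (gram X)

/-- The denominator, as a function of the factors `N` of the matrices `N Nᵀ`. -/
def denFun (X : Fin d × Fin 4 × Fin 3 → ℂ) : ℂ := f.den.eval (gram X)

theorem isPolynomialFun_numFun : IsPolynomialFun f.numFun :=
  (isPolynomialFun_eval f.num).comp isPolynomialFun_gram

theorem isPolynomialFun_denFun : IsPolynomialFun f.denFun :=
  (isPolynomialFun_eval f.den).comp isPolynomialFun_gram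

theorem exists_denFun_ne_zero : ∃ X, f.denFun X ≠ 0 := by
  obtain ⟨C, hC⟩ := f.den_ne
  obtain ⟨X, hX⟩ := exists_coords_eq_gram C
  exact ⟨X, by rwa [denFun, ← hX]⟩

/-- The pullback of `f` to tuples of factors is unchanged by the map `τ`. -/
def IsPreservedBy (τ : (Fin d × Fin 4 × Fin 3 → ℂ) → (Fin d × Fin 4 × Fin 3 → ℂ)) : Prop :=
  ∀ X, f.numFun X * f.denFun (τ X) = f.numFun (τ X) * f.denFun X

variable {f}

/-- Numerator and denominator have the same multidegree, so rescaling the representatives multiplies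
both by the same nonzero number. -/
theorem isDefinedAt_and_value_eq {C : Fin d → SpaceConic} {X : Fin d × Fin 4 × Fin 3 → ℂ}
    (hX : ∀ i, ∃ a : ℂ, a ≠ 0 ∧ (C i).mat = a • (slice X i * (slice X i)ᵀ))
    (h0 : f.denFun X ≠ 0) : f.IsDefinedAt C ∧ f.value C = f.numFun X / f.denFun X := by
  choose a ha hC using hX
  have hco : coords C = fun v => a v.1 * gram X v := by
    funext v
    exact congrFun (congrFun (hC v.1) v.2.1) v.2.2
  have hp : ∏ i, a i ^ f.degree i ≠ 0 := Finset.prod_ne_zero_iff.2 fun i _ => pow_ne_zero _ (ha i)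
  rw [IsDefinedAt, value, hco, f.num_hom.eval_smul, f.den_hom.eval_smul]
  exact ⟨mul_ne_zero hp h0, mul_div_mul_left _ _ hp⟩

/-- The two cross-multiplied identities chain after multiplication by `f.denFun (τ X)`. Surjectivity
of `τ` keeps this factor from vanishing identically, so it cancels. -/
theorem IsPreservedBy.comp {τ ρ : (Fin d × Fin 4 × Fin 3 → ℂ) → (Fin d × Fin 4 × Fin 3 → ℂ)}
    (hρ : f.IsPreservedBy ρ) (hτ : f.IsPreservedBy τ)
    (hρp : ∀ v, IsPolynomialFun fun X => ρ X v) (hτp : ∀ v, IsPolynomialFun fun X => τ X v)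
    (hs : Function.Surjective τ) : f.IsPreservedBy (fun X => ρ (τ X)) := by
  intro X
  have hρτ : ∀ v, IsPolynomialFun fun X => ρ (τ X) v := fun v => (hρp v).comp hτp
  have hn := f.isPolynomialFun_numFun
  have hd := f.isPolynomialFun_denFun
  obtain ⟨Y, hY⟩ := f.exists_denFun_ne_zero
  obtain ⟨Y, rfl⟩ := hs Y
  refine sub_eq_zero.1 (IsPolynomialFun.eq_zero_of_mul_eq_zero (hd.comp hτp)
    ((hn.mul (hd.comp hρτ)).sub ((hn.comp hρτ).mul hd)) (fun X => ?_) ⟨Y, hY⟩ X)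
  have h1 := hτ X
  have h2 := hρ (τ X)
  linear_combination f.denFun (ρ (τ X)) * h1 + f.denFun X * h2

end RationalFunction

theorem Camera.exists_right_inverse (P : Camera) : ∃ R : Matrix (Fin 4) (Fin 3) ℂ, P.mat * R = 1 :=
  exists_right_inverse_of_rank_eq P.rank_eq

namespace RationalFunction

variable {d : ℕ} {f : RationalFunction d}

/-- The product of the determinants of the matrices `P N`. -/
def detFun (P : Camera) (X : Fin d × Fin 4 × Fin 3 → ℂ) : ℂ := ∏ i, (P.mat * slice X i).det

theorem isPolynomialFun_detFun (P : Camera) : IsPolynomialFun (detFun (d := d) P) :=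
  .prod _ fun i => ((IsPolynomialMatrix.const P.mat).mul (isPolynomialMatrix_slice i)).det

theorem detFun_ne_zero_iff {P : Camera} {X : Fin d × Fin 4 × Fin 3 → ℂ} :
    detFun P X ≠ 0 ↔ ∀ i, (P.mat * slice X i).det ≠ 0 := by
  simp [detFun, Finset.prod_ne_zero_iff]

/-- The entries of the matrices of the images under `P`, as functions of the factors. -/
def imageCoords (P : Camera) (X : Fin d × Fin 4 × Fin 3 → ℂ) : Fin d × Fin 3 × Fin 3 → ℂ :=
  fun v => (P.mat * slice X v.1 * (P.mat * slice X v.1)ᵀ).adjugate v.2.1 v.2.2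

theorem isPolynomialFun_imageCoords (P : Camera) (v : Fin d × Fin 3 × Fin 3) :
    IsPolynomialFun (imageCoords (d := d) P · v) := by
  have h := (IsPolynomialMatrix.const P.mat).mul (isPolynomialMatrix_slice (d := d) v.1)
  exact (h.mul h.transpose).adjugate v.2.1 v.2.2

/-- A right inverse of `P` lifts any tuple of plane conics to factors, so an open condition on
images is satisfied by some tuple of factors. -/
theorem exists_generic_image (P : Camera) {w : MvPolynomial (Fin d × Fin 3 × Fin 3) ℂ}
    {e : Fin d → ℕ} (hw : IsMultihomogeneous w e)
    (hA : ∃ A : Fin d → PlaneConic, w.eval (coords A) ≠ 0) :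
    ∃ X, detFun P X ≠ 0 ∧ w.eval (imageCoords P X) ≠ 0 := by
  obtain ⟨A, hA⟩ := hA
  obtain ⟨R, hR⟩ := P.exists_right_inverse
  choose H hH hAH using fun i => (A i).exists_adjugate_eq
  let X : Fin d × Fin 4 × Fin 3 → ℂ := fun v => (R * H v.1) v.2.1 v.2.2
  have hX : ∀ i, P.mat * slice X i = H i := fun i => by
    have : slice X i = R * H i := rfl
    rw [this, ← Matrix.mul_assoc, hR, Matrix.one_mul]
  refine ⟨X, detFun_ne_zero_iff.2 fun i => by rw [hX]; exact hH i, ?_⟩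
  have hE : imageCoords P X = fun v => (A v.1).mat.det * coords A v := by
    funext v
    rw [imageCoords, hX, ← hAH, PlaneConic.adjugate_adjugate_mat]
    rfl
  rw [hE, hw.eval_smul fun i => (A i).mat.det]
  exact mul_ne_zero (Finset.prod_ne_zero_iff.2 fun i _ => pow_ne_zero _ (A i).det_ne_zero) hA

theorem exists_tuple_of_detFun_ne_zero {P : Camera} {X : Fin d × Fin 4 × Fin 3 → ℂ}
    (h : detFun P X ≠ 0) : ∃ C : Fin d → SpaceConic,
      (∀ i, ∃ a : ℂ, a ≠ 0 ∧ (C i).mat = a • (slice X i * (slice X i)ᵀ)) ∧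
      ∀ i, IsImage P (C i) (PlaneConic.ofEnvelope (P.mat * slice X i) (detFun_ne_zero_iff.1 h i)) :=
  have hN := fun i => rank_mul_transpose_eq (detFun_ne_zero_iff.1 h i)
  ⟨fun i => Conic.ofFactor (slice X i) (hN i), fun _ => Conic.exists_mat_mk _ _ _,
    fun i => isImage_ofEnvelope _ rfl (hN i)⟩

/-- For generic `X`, the conics with factors `X` and `τ X` have the same image, hence the same value
of `f`. The four polynomials that express genericity are cancelled one after another. -/
theorem IsComputableFromImage.isPreservedBy_of_image_eq {P : Camera}
    (hf : f.IsComputableFromImage {P})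
    {τ : (Fin d × Fin 4 × Fin 3 → ℂ) → (Fin d × Fin 4 × Fin 3 → ℂ)}
    (hτp : ∀ v, IsPolynomialFun fun X => τ X v) (hs : Function.Surjective τ)
    (hτ : ∀ X i, P.mat * slice (τ X) i = P.mat * slice X i) : f.IsPreservedBy τ := by
  obtain ⟨h, w, e, hw, hA, hh⟩ := hf
  obtain ⟨Y, hY1, hY2⟩ := exists_generic_image P hw hA
  obtain ⟨Z, hZ⟩ := f.exists_denFun_ne_zero
  obtain ⟨Z', hZ'⟩ := hs Z
  have hn := f.isPolynomialFun_numFun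
  have hd := f.isPolynomialFun_denFun
  have hδ := (hn.mul (hd.comp hτp)).sub ((hn.comp hτp).mul hd)
  have hwp : IsPolynomialFun fun X => w.eval (imageCoords P X) :=
    (isPolynomialFun_eval w).comp (isPolynomialFun_imageCoords P)
  intro X
  refine sub_eq_zero.1 (IsPolynomialFun.eq_zero_of_mul_eq_zero hd hδ (fun X => ?_) ⟨Z, hZ⟩ X)
  refine IsPolynomialFun.eq_zero_of_mul_eq_zero (hd.comp hτp) (hd.mul hδ) (fun X => ?_)
    ⟨Z', by rwa [hZ']⟩ X
  refine IsPolynomialFun.eq_zero_of_mul_eq_zero hwp ((hd.comp hτp).mul (hd.mul hδ)) (fun X => ?_)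
    ⟨Y, hY2⟩ X
  refine IsPolynomialFun.eq_zero_of_mul_eq_zero (isPolynomialFun_detFun P)
    (hwp.mul ((hd.comp hτp).mul (hd.mul hδ))) (fun X => ?_) ⟨Y, hY1⟩ X
  by_contra hne
  simp only [mul_eq_zero, not_or] at hne
  obtain ⟨h1, h2, h3, h4, h5⟩ := hne
  apply h5
  have h1' : detFun P (τ X) ≠ 0 := by
    simp only [detFun, hτ]
    exact h1
  obtain ⟨C, hC, hCi⟩ := exists_tuple_of_detFun_ne_zero h1
  obtain ⟨C', hC', hCi'⟩ := exists_tuple_of_detFun_ne_zero h1'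
  set A : Fin d → PlaneConic :=
    fun i => PlaneConic.ofEnvelope (P.mat * slice X i) (detFun_ne_zero_iff.1 h1 i) with hAdef
  have hwA : w.eval (coords A) ≠ 0 := by
    choose a ha hAa using fun i =>
      PlaneConic.exists_mat_ofEnvelope (P.mat * slice X i) (detFun_ne_zero_iff.1 h1 i)
    have hE : coords A = fun v => a v.1 * imageCoords P X v := by
      funext v
      exact congrFun (congrFun (hAa v.1) v.2.1) v.2.2
    rw [hE, hw.eval_smul]
    exact mul_ne_zero (Finset.prod_ne_zero_iff.2 fun i _ => pow_ne_zero _ (ha i)) h2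
  obtain ⟨hdC, hvC⟩ := isDefinedAt_and_value_eq hC h4
  obtain ⟨hdC', hvC'⟩ := isDefinedAt_and_value_eq hC' h3
  have e1 := hh P rfl C A hCi hdC hwA
  have e2 := hh P rfl C' A (fun i => by simpa only [hAdef, hτ] using hCi' i) hdC' hwA
  rw [← e2, hvC, hvC', div_eq_div_iff h4 h3] at e1
  exact sub_eq_zero.2 e1

/-- The camera is auxiliary: `detFun P X ≠ 0` ensures that the factors have rank 3 and define
conics. -/
theorem IsInvariant.isPreservedBy (hf : f.IsInvariant) (P : Camera) (g : GL (Fin 4) ℂ)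
    {τ : (Fin d × Fin 4 × Fin 3 → ℂ) → (Fin d × Fin 4 × Fin 3 → ℂ)}
    (hτp : ∀ v, IsPolynomialFun fun X => τ X v) (hs : Function.Surjective τ)
    (hτ : ∀ X i, slice (τ X) i = g.1 * slice X i) : f.IsPreservedBy τ := by
  obtain ⟨R, hR⟩ := P.exists_right_inverse
  have hY : detFun (d := d) P (fun v => R v.2.1 v.2.2) ≠ 0 :=
    detFun_ne_zero_iff.2 fun i => by
      have : slice (fun v : Fin d × Fin 4 × Fin 3 => R v.2.1 v.2.2) i = R := rfl
      rw [this, hR, det_one]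
      exact one_ne_zero
  obtain ⟨Z, hZ⟩ := f.exists_denFun_ne_zero
  obtain ⟨Z', hZ'⟩ := hs Z
  have hn := f.isPolynomialFun_numFun
  have hd := f.isPolynomialFun_denFun
  have hδ := (hn.mul (hd.comp hτp)).sub ((hn.comp hτp).mul hd)
  intro X
  refine sub_eq_zero.1 (IsPolynomialFun.eq_zero_of_mul_eq_zero hd hδ (fun X => ?_) ⟨Z, hZ⟩ X)
  refine IsPolynomialFun.eq_zero_of_mul_eq_zero (hd.comp hτp) (hd.mul hδ) (fun X => ?_)
    ⟨Z', by rwa [hZ']⟩ X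
  refine IsPolynomialFun.eq_zero_of_mul_eq_zero (isPolynomialFun_detFun P)
    ((hd.comp hτp).mul (hd.mul hδ)) (fun X => ?_) ⟨_, hY⟩ X
  by_contra hne
  simp only [mul_eq_zero, not_or] at hne
  obtain ⟨h1, h3, h4, h5⟩ := hne
  apply h5
  obtain ⟨C, hC, -⟩ := exists_tuple_of_detFun_ne_zero h1
  have hC' : ∀ i, ∃ a : ℂ, a ≠ 0 ∧
      ((C i).transform g).mat = a • (slice (τ X) i * (slice (τ X) i)ᵀ) := fun i => by
    obtain ⟨a, ha, hCa⟩ := hC i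
    obtain ⟨b, hb, hCb⟩ : ∃ b : ℂ, b ≠ 0 ∧
        ((C i).transform g).mat = b • (g.1 * (C i).mat * g.1.transpose) :=
      Conic.exists_mat_mk _ _ _
    refine ⟨b * a, mul_ne_zero hb ha, ?_⟩
    rw [hCb, hCa, hτ, transpose_mul, Matrix.mul_smul, Matrix.smul_mul, smul_smul]
    simp only [Matrix.mul_assoc]
  obtain ⟨hdC, hvC⟩ := isDefinedAt_and_value_eq hC h4
  obtain ⟨hdC', hvC'⟩ := isDefinedAt_and_value_eq hC' h3
  have e1 := hf g C hdC hdC'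
  rw [hvC, hvC', div_eq_div_iff h3 h4] at e1
  exact sub_eq_zero.2 e1.symm

/-- The tuple of rank-one matrices `x uᵢᵀ`. -/
def rankOneTuple (x : Fin 4 → ℂ) (u : Fin d → Fin 3 → ℂ) : Fin d × Fin 4 × Fin 3 → ℂ :=
  fun v => x v.2.1 * u v.1 v.2.2

theorem isPolynomialFun_translation (a : Fin d × Fin 4 × Fin 3 → ℂ) (v : Fin d × Fin 4 × Fin 3) :
    IsPolynomialFun fun X : Fin d × Fin 4 × Fin 3 → ℂ => (X + a) v :=
  (IsPolynomialFun.coord v).add (.const (a v))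

theorem IsComputableFromImage.isPreservedBy_translation {P : Camera}
    (hf : f.IsComputableFromImage {P}) {x : Fin 4 → ℂ} (hx : P.mat *ᵥ x = 0)
    (u : Fin d → Fin 3 → ℂ) : f.IsPreservedBy (· + rankOneTuple x u) := by
  refine hf.isPreservedBy_of_image_eq (isPolynomialFun_translation _)
    (add_right_surjective _) fun X i => ?_
  have h : slice (X + rankOneTuple x u) i = slice X i + vecMulVec x (u i) := rfl
  rw [h, Matrix.mul_add, mul_vecMulVec, hx, zero_vecMulVec, add_zero]

theorem IsPreservedBy.translation_add {a b : Fin d × Fin 4 × Fin 3 → ℂ}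
    (ha : f.IsPreservedBy (· + a)) (hb : f.IsPreservedBy (· + b)) :
    f.IsPreservedBy (· + (a + b)) := by
  have h := hb.comp ha (isPolynomialFun_translation b) (isPolynomialFun_translation a)
    (add_right_surjective a)
  simpa only [add_assoc] using h

/-- Scaling and differences extend the affine points to all vectors `x`; the resulting rank-one
tuples include every coordinate vector, so all translations preserve `f`, and they act transitively.
-/
theorem isConstant_of_isPreservedBy_translations
    (h : ∀ (o : Fin 3 → ℂ) (u : Fin d → Fin 3 → ℂ),
      f.IsPreservedBy (· + rankOneTuple ![o 0, o 1, o 2, 1] u)) : f.IsConstant := by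
  have h1 : ∀ (x : Fin 4 → ℂ) (u : Fin d → Fin 3 → ℂ), x 3 ≠ 0 →
      f.IsPreservedBy (· + rankOneTuple x u) := fun x u hx => by
    have e : rankOneTuple x u =
        rankOneTuple ![x 0 / x 3, x 1 / x 3, x 2 / x 3, 1] (fun i c => x 3 * u i c) := by
      funext ⟨i, a, c⟩
      fin_cases a <;> simp [rankOneTuple] <;> field_simp
    rw [e]
    exact h ![x 0 / x 3, x 1 / x 3, x 2 / x 3] _
  have h2 : ∀ (x : Fin 4 → ℂ) (u : Fin d → Fin 3 → ℂ),
      f.IsPreservedBy (· + rankOneTuple x u) := fun x u => by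
    by_cases hx : x 3 = 0
    -- A vector at infinity is the difference of two vectors with last coordinate 1.
    · have e : rankOneTuple x u = rankOneTuple (x + Pi.single 3 1) u +
          rankOneTuple (Pi.single 3 1) (-u) := by
        funext v
        simp only [rankOneTuple, Pi.add_apply, Pi.neg_apply]
        ring
      rw [e]
      exact (h1 _ _ (by simp [hx])).translation_add (h1 _ _ (by simp))
    · exact h1 x u hx
  have h3 : ∀ a : Fin d × Fin 4 × Fin 3 → ℂ, f.IsPreservedBy (· + a) := by
    have hsum : ∀ (a : Fin d × Fin 4 × Fin 3 → ℂ) (s : Finset (Fin d × Fin 4 × Fin 3)),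
        f.IsPreservedBy (· + ∑ v ∈ s, Pi.single v (a v)) := fun a s => by
      induction s using Finset.induction_on with
      | empty => intro X; simp
      | insert v s hv ih =>
        rw [Finset.sum_insert hv]
        refine IsPreservedBy.translation_add ?_ ih
        have e : (Pi.single v (a v) : Fin d × Fin 4 × Fin 3 → ℂ) =
            rankOneTuple (Pi.single v.2.1 1) (fun i c => if i = v.1 ∧ c = v.2.2 then a v else 0) := by
          obtain ⟨i, k, c⟩ := v
          funext ⟨i', k', c'⟩
          by_cases hi : i' = i <;> by_cases hk : k' = k <;> by_cases hc : c' = c <;>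
            simp [rankOneTuple, hi, hk, hc]
        rw [e]
        exact h2 _ _
    intro a
    have := hsum a Finset.univ
    rwa [Finset.univ_sum_single] at this
  obtain ⟨Y, hY⟩ := f.exists_denFun_ne_zero
  refine ⟨f.numFun Y / f.denFun Y, fun C hC => ?_⟩
  obtain ⟨X, hX⟩ := exists_coords_eq_gram C
  rw [IsDefinedAt, hX] at hC
  rw [value, hX]
  have h4 := h3 (X - Y) Y
  simp only [add_sub_cancel] at h4
  exact (div_eq_div_iff hC hY).2 h4.symm

theorem isConstant_of_isComputableFromImage {K : Set Camera}
    (hK : ∀ o : Fin 3 → ℂ, ∃ P ∈ K, Camera.IsAt P o) (hf : f.IsComputableFromImage K) :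
    f.IsConstant := by
  refine isConstant_of_isPreservedBy_translations fun o u => ?_
  obtain ⟨P, hP, hPo⟩ := hK o
  obtain ⟨h, w, e, hw, hA, hh⟩ := hf
  have hfP : f.IsComputableFromImage {P} :=
    ⟨h, w, e, hw, hA, fun P' hP' => by rw [Set.mem_singleton_iff.1 hP']; exact hh P hP⟩
  exact hfP.isPreservedBy_translation hPo u

end RationalFunction

theorem exists_GL_mulVec_eq {x y : Fin 4 → ℂ} (hx : x ≠ 0) (hy : y ≠ 0) :
    ∃ g : GL (Fin 4) ℂ, g.1 *ᵥ x = y := by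
  obtain ⟨A, hA⟩ := SeparatingDual.exists_continuousLinearEquiv_apply_eq (R := ℂ) hx hy
  refine ⟨Matrix.GeneralLinearGroup.mkOfDetNeZero (LinearMap.toMatrix' A.toLinearEquiv.toLinearMap)
    ?_, ?_⟩
  · rw [LinearMap.det_toMatrix']
    exact A.toLinearEquiv.isUnit_det'.ne_zero
  · rw [← hA]
    exact LinearMap.toMatrix'_mulVec _ _

theorem Camera.exists_center (P : Camera) : ∃ x : Fin 4 → ℂ, x ≠ 0 ∧ P.mat *ᵥ x = 0 := by
  have h := LinearMap.ker_ne_bot_of_finrank_lt (f := P.mat.mulVecLin) (by simp)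
  obtain ⟨x, hx, hx0⟩ := Submodule.exists_mem_ne_zero_of_ne_bot h
  exact ⟨x, hx0, by simpa using hx⟩

/-! ### Invariant functions and a single camera -/

namespace RationalFunction

variable {d : ℕ} {f : RationalFunction d}

/-- The action of a matrix on tuples of factors. -/
def leftMul (g : Matrix (Fin 4) (Fin 4) ℂ) (X : Fin d × Fin 4 × Fin 3 → ℂ) :
    Fin d × Fin 4 × Fin 3 → ℂ :=
  fun v => (g * slice X v.1) v.2.1 v.2.2

theorem isPolynomialFun_leftMul (g : Matrix (Fin 4) (Fin 4) ℂ) (v : Fin d × Fin 4 × Fin 3) :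
    IsPolynomialFun fun X => leftMul g X v :=
  (IsPolynomialMatrix.const g).mul (isPolynomialMatrix_slice v.1) v.2.1 v.2.2

theorem slice_leftMul (g : Matrix (Fin 4) (Fin 4) ℂ) (X : Fin d × Fin 4 × Fin 3 → ℂ) (i : Fin d) :
    slice (leftMul g X) i = g * slice X i := rfl

theorem leftMul_leftMul (g h : Matrix (Fin 4) (Fin 4) ℂ) (X : Fin d × Fin 4 × Fin 3 → ℂ) :
    leftMul g (leftMul h X) = leftMul (g * h) X := by
  funext v
  rw [leftMul, slice_leftMul, leftMul, Matrix.mul_assoc]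

theorem leftMul_one (X : Fin d × Fin 4 × Fin 3 → ℂ) : leftMul 1 X = X := by
  funext v
  rw [leftMul, Matrix.one_mul]
  rfl

theorem leftMul_surjective (g : GL (Fin 4) ℂ) : Function.Surjective (leftMul (d := d) g.1) :=
  fun X => ⟨leftMul g⁻¹.1 X, by rw [leftMul_leftMul, ← Units.val_mul, mul_inv_cancel, Units.val_one,
    leftMul_one]⟩

theorem leftMul_add_rankOneTuple (g : Matrix (Fin 4) (Fin 4) ℂ) (X : Fin d × Fin 4 × Fin 3 → ℂ)
    (x : Fin 4 → ℂ) (u : Fin d → Fin 3 → ℂ) :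
    leftMul g (X + rankOneTuple x u) = leftMul g X + rankOneTuple (g *ᵥ x) u := by
  funext v
  have h : slice (X + rankOneTuple x u) v.1 = slice X v.1 + vecMulVec x (u v.1) := rfl
  rw [leftMul, h, Matrix.mul_add, mul_vecMulVec]
  rfl

/-- Conjugating the translation along the centre `x` by `g` gives the translation along `g *ᵥ x`,
and `g` can be chosen to send `x` to any affine point. -/
theorem IsInvariant.isConstant (hf : f.IsInvariant) {P : Camera}
    (hP : f.IsComputableFromImage {P}) : f.IsConstant := by
  refine isConstant_of_isPreservedBy_translations fun o u => ?_
  obtain ⟨x, hx, hPx⟩ := P.exists_center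
  obtain ⟨g, hg⟩ := exists_GL_mulVec_eq (y := ![o 0, o 1, o 2, 1]) hx
    (fun h => one_ne_zero (congrFun h 3))
  have hT := hP.isPreservedBy_translation hPx u
  have hG : ∀ g : GL (Fin 4) ℂ, f.IsPreservedBy (leftMul g.1) := fun g =>
    hf.isPreservedBy P g (isPolynomialFun_leftMul _) (leftMul_surjective g) (slice_leftMul _)
  have h1 := hT.comp (hG g⁻¹) (isPolynomialFun_translation _) (isPolynomialFun_leftMul _)
    (leftMul_surjective _)
  have h2 := (hG g).comp h1 (isPolynomialFun_leftMul _)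
    (fun v => (isPolynomialFun_translation _ v).comp (isPolynomialFun_leftMul _))
    ((add_right_surjective _).comp (leftMul_surjective _))
  simpa only [leftMul_add_rankOneTuple, leftMul_leftMul, ← Units.val_mul, mul_inv_cancel,
    Units.val_one, leftMul_one, hg] using h2

end RationalFunction

/-! ### Equivalence of image tuples -/

/-- The inclusion of the vectors with vanishing last coordinate. -/
def infinityInclusion : Matrix (Fin 4) (Fin 3) ℂ := !![1, 0, 0; 0, 1, 0; 0, 0, 1; 0, 0, 0]

theorem infinityInclusion_mulVec_add (o : Fin 3 → ℂ) :
    infinityInclusion *ᵥ o + ![0, 0, 0, 1] = ![o 0, o 1, o 2, 1] := by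
  funext a
  fin_cases a <;> simp [infinityInclusion, dotProduct, Fin.sum_univ_succ]

/-- The centre is not at infinity, so the camera is injective on the plane at infinity. -/
theorem Camera.IsAt.det_ne_zero {P : Camera} {o : Fin 3 → ℂ} (h : P.IsAt o) :
    (P.mat * infinityInclusion).det ≠ 0 := by
  obtain ⟨R, hR⟩ := P.exists_right_inverse
  -- Each column of `R` is a vector at infinity plus a multiple of the centre. The camera kills the
  -- latter, so `S` is a right inverse of `P.mat * infinityInclusion`.
  set S : Matrix (Fin 3) (Fin 3) ℂ := Matrix.of fun a b => R a.castSucc b - o a * R 3 b with hS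
  have hRS : R = infinityInclusion * S + vecMulVec ![o 0, o 1, o 2, 1] (R 3) := by
    ext a b
    rw [Matrix.add_apply, Matrix.mul_apply, Fin.sum_univ_three, vecMulVec_apply]
    fin_cases a <;> simp [infinityInclusion, hS]
  rw [hRS, Matrix.mul_add, mul_vecMulVec, show P.mat *ᵥ ![o 0, o 1, o 2, 1] = 0 from h,
    zero_vecMulVec, add_zero, ← Matrix.mul_assoc] at hR
  intro h0
  simpa [h0] using congrArg det hR

variable {d : ℕ} {K : Set Camera}

theorem imagesOfCommonModel_of_factors {P P' : Camera} (hP : P ∈ K) (hP' : P' ∈ K)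
    (N : Fin d → Matrix (Fin 4) (Fin 3) ℂ) {H H' : Fin d → Matrix (Fin 3) (Fin 3) ℂ}
    (h : ∀ i, (H i).det ≠ 0) (h' : ∀ i, (H' i).det ≠ 0) (hN : ∀ i, P.mat * N i = H i)
    (hN' : ∀ i, P'.mat * N i = H' i) :
    ImagesOfCommonModel K (fun i => PlaneConic.ofEnvelope (H i) (h i))
      (fun i => PlaneConic.ofEnvelope (H' i) (h' i)) :=
  have hr := fun i => rank_mul_transpose_eq (P := P.mat) (N := N i) (by rw [hN]; exact h i)
  ⟨P, hP, P', hP', fun i => Conic.ofFactor (N i) (hr i),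
    fun i => isImage_ofEnvelope _ (hN i) (hr i), fun i => isImage_ofEnvelope _ (hN' i) (hr i)⟩

/-- The tuple of plane conics with envelopes `Hᵢ Hᵢᵀ`. -/
def conicTuple (H : Fin d → GL (Fin 3) ℂ) (i : Fin d) : PlaneConic :=
  PlaneConic.ofEnvelope (H i).1 (H i).det_ne_zero

/-- Equivalence of the tuples of plane conics with given factors of their envelopes. -/
def FactorsEquivalent (K : Set Camera) (H H' : Fin d → GL (Fin 3) ℂ) : Prop :=
  Relation.EqvGen (ImagesOfCommonModel K) (conicTuple H) (conicTuple H')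

/-- The camera `P` sees `N` as `H` and `N + o uᵀ` as `H + (P o) uᵀ`, whereas a camera centred at `o`
cannot distinguish the two. -/
theorem factorsEquivalent_of_eq_add (hK : ∀ o : Fin 3 → ℂ, ∃ P ∈ K, Camera.IsAt P o)
    {H H' : Fin d → GL (Fin 3) ℂ} (y : Fin 3 → ℂ) (u : Fin d → Fin 3 → ℂ)
    (h : ∀ i, (H' i).1 = (H i).1 + vecMulVec y (u i)) : FactorsEquivalent K H H' := by
  obtain ⟨P, hP, hP0⟩ := hK 0
  set M := P.mat * infinityInclusion with hM
  have hMd : IsUnit M.det := hP0.det_ne_zero.isUnit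
  -- Since `P` kills the origin `![0, 0, 0, 1]`, it sends the affine point `o` to `M *ᵥ o`; this
  -- centre is chosen to make that equal to `y`.
  obtain ⟨P', hP', hPo⟩ := hK (M⁻¹ *ᵥ y)
  set o := M⁻¹ *ᵥ y with ho
  have hPy : P.mat *ᵥ ![o 0, o 1, o 2, 1] = y := by
    have h0 : P.mat *ᵥ ![0, 0, 0, 1] = 0 := hP0
    rw [← infinityInclusion_mulVec_add, mulVec_add, h0, add_zero, mulVec_mulVec, ← hM, ho,
      mulVec_mulVec, mul_nonsing_inv _ hMd, one_mulVec]
  -- The lift has its columns at infinity, so its image under every camera with an affine centre is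
  -- invertible.
  let N : Fin d → Matrix (Fin 4) (Fin 3) ℂ := fun i => infinityInclusion * (M⁻¹ * (H i).1)
  have hN : ∀ i, P.mat * N i = (H i).1 := fun i => by
    rw [← Matrix.mul_assoc, ← hM, mul_nonsing_inv_cancel_left _ _ hMd]
  have hN' : ∀ i, (P'.mat * N i).det ≠ 0 := fun i => by
    rw [← Matrix.mul_assoc, det_mul, det_mul]
    exact mul_ne_zero hPo.det_ne_zero
      (mul_ne_zero (isUnit_nonsing_inv_det _ hMd).ne_zero (H i).det_ne_zero)
  refine .trans _ (fun i => PlaneConic.ofEnvelope (P'.mat * N i) (hN' i)) _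
    (.rel _ _ (imagesOfCommonModel_of_factors hP hP' N _ _ hN fun _ => rfl))
    (.rel _ _ (imagesOfCommonModel_of_factors hP' hP
      (fun i => N i + vecMulVec ![o 0, o 1, o 2, 1] (u i)) _ _ (fun i => ?_) fun i => ?_))
  · rw [Matrix.mul_add, mul_vecMulVec, show P'.mat *ᵥ ![o 0, o 1, o 2, 1] = 0 from hPo,
      zero_vecMulVec, add_zero]
  · rw [Matrix.mul_add, mul_vecMulVec, hPy, hN, h]

/-- Left multiplication by `T` in any one component preserves the equivalence class. -/
def IsAdmissibleFactor (d : ℕ) (K : Set Camera) (T : Matrix (Fin 3) (Fin 3) ℂ) : Prop :=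
  ∀ (hT : T.det ≠ 0) (H : Fin d → GL (Fin 3) ℂ) (i : Fin d),
    FactorsEquivalent K H (Function.update H i (GeneralLinearGroup.mkOfDetNeZero T hT * H i))

theorem isAdmissibleFactor_one_add_vecMulVec (hK : ∀ o : Fin 3 → ℂ, ∃ P ∈ K, Camera.IsAt P o)
    (y w : Fin 3 → ℂ) : IsAdmissibleFactor d K (1 + vecMulVec y w) := by
  intro hT H i
  -- The increment `y wᵀ Hᵢ` is again `y` times a row vector; the other components get the zero row.
  refine factorsEquivalent_of_eq_add hK y (Function.update 0 i (w ᵥ* (H i).1)) fun j => ?_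
  by_cases hj : j = i
  · subst hj
    rw [Function.update_self, Function.update_self, Units.val_mul]
    change (1 + vecMulVec y w) * _ = _
    rw [Matrix.add_mul, Matrix.one_mul, vecMulVec_mul]
  · simp [hj]

theorem IsAdmissibleFactor.mul {S T : Matrix (Fin 3) (Fin 3) ℂ} (hS : IsAdmissibleFactor d K S)
    (hT : IsAdmissibleFactor d K T) : IsAdmissibleFactor d K (S * T) := by
  intro h H i
  rw [det_mul, mul_ne_zero_iff] at h
  have h1 := hT h.2 H i
  have h2 := hS h.1 (Function.update H i (GeneralLinearGroup.mkOfDetNeZero T h.2 * H i)) i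
  rw [Function.update_self, Function.update_idem, ← mul_assoc] at h2
  have e : GeneralLinearGroup.mkOfDetNeZero (S * T) (by rw [det_mul]; exact mul_ne_zero h.1 h.2) =
      GeneralLinearGroup.mkOfDetNeZero S h.1 * GeneralLinearGroup.mkOfDetNeZero T h.2 :=
    Units.ext rfl
  rw [e]
  exact h1.trans _ _ _ h2

/-- Changing one diagonal entry of the identity is a rank-one perturbation. Zero entries of `D` do
no harm, since admissibility of a singular matrix is vacuous. -/
theorem isAdmissibleFactor_diagonal (hK : ∀ o : Fin 3 → ℂ, ∃ P ∈ K, Camera.IsAt P o)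
    (D : Fin 3 → ℂ) : IsAdmissibleFactor d K (diagonal D) := by
  have h1 : ∀ (k : Fin 3) (c : ℂ), IsAdmissibleFactor d K
      (diagonal (Function.update (1 : Fin 3 → ℂ) k c)) := fun k c => by
    have e : diagonal (Function.update (1 : Fin 3 → ℂ) k c) =
        1 + vecMulVec (Pi.single k (c - 1)) (Pi.single k 1) := by
      ext a b
      by_cases hab : a = b
      · subst hab
        by_cases hak : a = k
        · subst hak
          simp [vecMulVec_apply]
        · simp [vecMulVec_apply, hak]
      · by_cases hak : a = k
        · subst hak
          simp [vecMulVec_apply, hab, Ne.symm hab]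
        · simp [vecMulVec_apply, hak, hab]
    rw [e]
    exact isAdmissibleFactor_one_add_vecMulVec hK _ _
  have e : diagonal D = diagonal (Function.update 1 0 (D 0)) *
      diagonal (Function.update 1 1 (D 1)) * diagonal (Function.update 1 2 (D 2)) := by
    rw [diagonal_mul_diagonal, diagonal_mul_diagonal]
    congr 1
    funext a
    fin_cases a <;> simp
  rw [e]
  exact ((h1 _ _).mul (h1 _ _)).mul (h1 _ _)

/-- Transvections and invertible diagonal matrices generate GL₃, and a transvection is a rank-one
perturbation of the identity. -/
theorem isAdmissibleFactor (hK : ∀ o : Fin 3 → ℂ, ∃ P ∈ K, Camera.IsAt P o)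
    {T : Matrix (Fin 3) (Fin 3) ℂ} (hT : T.det ≠ 0) : IsAdmissibleFactor d K T := by
  refine diagonal_transvection_induction_of_det_ne_zero _ T hT
    (fun D _ => isAdmissibleFactor_diagonal hK D) (fun t => ?_) fun A B _ _ hA hB => hA.mul hB
  have e : t.toMatrix = 1 + vecMulVec (Pi.single t.i t.c) (Pi.single t.j 1) := by
    ext a b
    simp only [TransvectionStruct.toMatrix, transvection, Matrix.add_apply, vecMulVec_apply,
      Matrix.single_apply, Pi.single_apply, eq_comm (a := a), eq_comm (a := b)]
    split_ifs <;> simp_all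
  rw [e]
  exact isAdmissibleFactor_one_add_vecMulVec hK _ _

theorem factorsEquivalent (hK : ∀ o : Fin 3 → ℂ, ∃ P ∈ K, Camera.IsAt P o)
    (H H' : Fin d → GL (Fin 3) ℂ) : FactorsEquivalent K H H' := by
  have h : ∀ s : Finset (Fin d), FactorsEquivalent K H (s.piecewise H' H) := fun s => by
    induction s using Finset.induction_on with
    | empty =>
      rw [Finset.piecewise_empty]
      exact .refl _
    | insert i s _ ih =>
      refine .trans _ _ _ ih ?_
      set G := s.piecewise H' H
      -- Components are replaced one at a time: this multiplier turns `G i` into `H' i`.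
      have h1 := isAdmissibleFactor hK (H' i * (G i)⁻¹).det_ne_zero
        (H' i * (G i)⁻¹).det_ne_zero G i
      have e : GeneralLinearGroup.mkOfDetNeZero (H' i * (G i)⁻¹).1 (H' i * (G i)⁻¹).det_ne_zero =
          H' i * (G i)⁻¹ := Units.ext rfl
      rw [e, inv_mul_cancel_right] at h1
      rw [Finset.piecewise_insert]
      exact h1
  have := h Finset.univ
  rwa [Finset.piecewise_univ] at this

theorem exists_eq_conicTuple (A : Fin d → PlaneConic) :
    ∃ H : Fin d → GL (Fin 3) ℂ, A = conicTuple H := by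
  choose H h hA using fun i => (A i).exists_eq_ofEnvelope
  exact ⟨fun i => GeneralLinearGroup.mkOfDetNeZero (H i) (h i), funext hA⟩

theorem eqvGen_imagesOfCommonModel (hK : ∀ o : Fin 3 → ℂ, ∃ P ∈ K, Camera.IsAt P o)
    (A B : Fin d → PlaneConic) : Relation.EqvGen (ImagesOfCommonModel K) A B := by
  obtain ⟨H, rfl⟩ := exists_eq_conicTuple A
  obtain ⟨H', rfl⟩ := exists_eq_conicTuple B
  exact factorsEquivalent hK H H'

end ConicImaging

end

theorem mainTheorem1 (d : ℕ) (K : Set ConicImaging.Camera)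
    (hK : ∀ o : Fin 3 → ℂ, ∃ P ∈ K, ConicImaging.Camera.IsAt P o) :
    (∀ A B : Fin d → ConicImaging.PlaneConic,
      Relation.EqvGen (ConicImaging.ImagesOfCommonModel K) A B) ∧
    (∀ f : ConicImaging.RationalFunction d, f.IsComputableFromImage K → f.IsConstant) ∧
    (∀ (f : ConicImaging.RationalFunction d) (P : ConicImaging.Camera),
      f.IsInvariant → f.IsComputableFromImage {P} → f.IsConstant) :=
  ⟨fun A B => ConicImaging.eqvGen_imagesOfCommonModel hK A B,
    fun _ hf => ConicImaging.RationalFunction.isConstant_of_isComputableFromImage hK hf,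
    fun _ _ hf hP => hf.isConstant hP⟩
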